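/- Let $$\mathbf G_2=\begin{pmatrix}\frac{\sqrt3-1}{2\sqrt2}&-\frac{\sqrt3+1}{2\sqrt2}\\[2pt]-\frac{\sqrt3+1}{2\sqrt2}&\frac{\sqrt3-1}{2\sqrt2}\end{pmatrix},$$ a generator matrix (by rows) of a hexagonal lattice $L=\{\mathbf f^T\mathbf G_2:\mathbf f\in\mathbb Z^2\}$. Let $\rho_c$ be its covering radius (the largest distance from a boundary point of the Voronoi cell of a lattice point to that lattice point), $\Theta=\pi\rho_c^2/|\det\mathbf G_2|$ its thickness, and, for an integer $n\ge 2$, let $l=(n\pi/\Theta)^{1/2}\rho_c$. Say that a set $\mathbf D\subset[0,1]^2$ is an $n$-point rotated sphere packing design with generator matrix $\mathbf G_2$ and rotation matrix $\mathbf I_2$ if it is obtained as follows: take a finite subset $\mathbf E$ of $L$ that contains $L\cap[-l/2-\rho_c,\,l/2+\rho_c]^2$; take any $\boldsymbol\delta=(\delta_1,\delta_2)$ in the closed Voronoi cell of the origin in $\mathbf E$ such that exactly $n$ points of $\mathbf E$ lie in $[-l/2-\delta_1,l/2-\delta_1]\times[-l/2-\delta_2,l/2-\delta_2]$; and let $$\mathbf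 D=\Bigl\{\tfrac{1}{l}(\mathbf e+\boldsymbol\delta)+(\tfrac12,\tfrac12):\mathbf e\in\mathbf E\Bigr\}\cap[0,1]^2 .$$ Let the extreme discrepancy of $\mathbf D$ be $$P(\mathbf D)=\sup\Bigl|\frac{\#\{\mathbf x\in\mathbf D: u_k\le x_k<v_k,\ k=1,2\}}{\#\mathbf D}-(v_1-u_1)(v_2-u_2)\Bigr|,$$ the supremum being over $\mathbf u,\mathbf v\in[0,1]^2$ with $u_1<v_1$ and $u_2<v_2$. **Theorem.** For every $n\ge2$ and every such $n$-point design $\mathbf D$: (i) $P(\mathbf D)\le C\,n^{-1}\log n$, with an absolute constant $C$ (independent of $n$ and of the choices made in the construction); (ii) any two distinct points $\mathbf x,\mathbf y\in\mathbf D$ satisfy $|x_2-y_2|\ge\frac{\sqrt3}{6}\,n^{-1}$; (iii) for every $\mathbf x\in\mathbf D$ whose second coordinate is not the largest one in $\mathbf D$, $$\min_{\mathbf y\in\mathbf D,\ y_2>x_2}|y_2-x_2|\le\Bigl(\frac{2\sqrt3}{3}+1\Bigr)n^{-1}.$$ -/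

import Mathlib

open scoped Matrix

noncomputable section

namespace RSPD

variable {p : ℕ}

/-- The Euclidean distance of two points of `ℝ^p`, the points being given by their coordinates. -/
def eDist (x y : Fin p → ℝ) : ℝ := dist (WithLp.toLp 2 x) (WithLp.toLp 2 y)

/-- The point `f^T M` for an integer vector `f`. -/
def latticePoint (M : Matrix (Fin p) (Fin p) ℝ) (f : Fin p → ℤ) : Fin p → ℝ :=
  (fun i => (f i : ℝ)) ᵥ* M

/-- The lattice generated by the rows of `M`. -/
def lattice (M : Matrix (Fin p) (Fin p) ℝ) : Set (Fin p → ℝ) := Set.range (latticePoint M)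

/-- The (closed) Voronoi cell of the point `c` in the point set `E`. -/
def voronoiCell (E : Set (Fin p → ℝ)) (c : Fin p → ℝ) : Set (Fin p → ℝ) :=
  {x | ∀ y ∈ E, eDist x c ≤ eDist x y}

/-- The covering radius `ρ_c` of the lattice with generator matrix `G`: the largest distance from a
point on the boundary of a Voronoi cell to its center. -/
def coveringRadius (G : Matrix (Fin p) (Fin p) ℝ) : ℝ :=
  sSup ((fun x => eDist x 0) '' frontier (voronoiCell (lattice G) 0))

/-- The volume `Ω_p` of the unit ball of `ℝ^p`. -/
def unitBallVolume (p : ℕ) : ℝ := Real.pi ^ ((p : ℝ) / 2) / Real.Gamma ((p : ℝ) / 2 + 1)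

/-- The thickness `Θ` of the lattice with generator matrix `G`: the volume of a ball of radius `ρ_c`
over the volume `|det G|` of one cell of the lattice. -/
def thickness (G : Matrix (Fin p) (Fin p) ℝ) : ℝ :=
  unitBallVolume p * coveringRadius G ^ p / |G.det|

/-- The scale `l = (n Ω_p / Θ)^{1/p} ρ_c`. -/
def scale (n : ℕ) (G : Matrix (Fin p) (Fin p) ℝ) : ℝ :=
  ((n : ℝ) * unitBallVolume p / thickness G) ^ (1 / (p : ℝ)) * coveringRadius G

/-- The rows of the large design `E = F G R`, the rows of the integer matrix `F` being given as a
finite set. -/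
def largeDesign (F : Finset (Fin p → ℤ)) (G R : Matrix (Fin p) (Fin p) ℝ) :
    Set (Fin p → ℝ) :=
  latticePoint (G * R) '' (F : Set (Fin p → ℤ))

/-- `F` is sufficiently large: `E = F G R` contains all points of the lattice generated by `G R`
that lie in the cube `[-l/2 - ρ_c, l/2 + ρ_c]^p`. -/
def SufficientlyLarge (n : ℕ) (G R : Matrix (Fin p) (Fin p) ℝ) (F : Finset (Fin p → ℤ)) : Prop :=
  lattice (G * R) ∩
      {x | ∀ k, x k ∈ Set.Icc (-(scale n G / 2) - coveringRadius G)
        (scale n G / 2 + coveringRadius G)} ⊆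
    largeDesign F G R

/-- The shift `δ` lies in the Voronoi cell of the origin in `E = F G R`, and exactly `n` points of
`E` lie in the box `∏ₖ [-l/2 - δₖ, l/2 - δₖ]`. -/
def IsPerturbation (n : ℕ) (G R : Matrix (Fin p) (Fin p) ℝ) (F : Finset (Fin p → ℤ))
    (δ : Fin p → ℝ) : Prop :=
  δ ∈ voronoiCell (largeDesign F G R) 0 ∧
    (largeDesign F G R ∩
      {x | ∀ k, x k ∈ Set.Icc (-(scale n G / 2) - δ k) (scale n G / 2 - δ k)}).ncard = n

/-- The points of `(E + δ) / l + 1/2` that lie in `[0,1]^p`, where `E = F G R`. -/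
def extracted (n : ℕ) (G R : Matrix (Fin p) (Fin p) ℝ) (F : Finset (Fin p → ℤ))
    (δ : Fin p → ℝ) : Set (Fin p → ℝ) :=
  (fun (x : Fin p → ℝ) (k : Fin p) => (x k + δ k) / scale n G + 1 / 2) '' largeDesign F G R ∩
    {x | ∀ k, x k ∈ Set.Icc (0 : ℝ) 1}

/-- `D` is an `n`-point rotated sphere packing design with generator matrix `G` and rotation
matrix `R`, that is, a possible output of the construction algorithm. -/
def IsDesign (n : ℕ) (G R : Matrix (Fin p) (Fin p) ℝ) (D : Set (Fin p → ℝ)) : Prop :=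
  ∃ (F : Finset (Fin p → ℤ)) (δ : Fin p → ℝ),
    SufficientlyLarge n G R F ∧ IsPerturbation n G R F δ ∧ D = extracted n G R F δ

/-- The extreme discrepancy of a finite point set `D`: the supremum of
`|A(u,v,D) / |D| - ∏ₖ (vₖ - uₖ)|` over `u, v ∈ [0,1]^p` with `uₖ < vₖ` for all `k`, where
`A(u,v,D)` is the number of points of `D` in `∏ₖ [uₖ, vₖ)`. -/
def extremeDiscrepancy (D : Set (Fin p → ℝ)) : ℝ :=
  sSup {t | ∃ u v : Fin p → ℝ,
    (∀ k, u k ∈ Set.Icc (0 : ℝ) 1) ∧ (∀ k, v k ∈ Set.Icc (0 : ℝ) 1) ∧ (∀ k, u k < v k) ∧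
      t = |((D ∩ {x | ∀ k, u k ≤ x k ∧ x k < v k}).ncard : ℝ) / (D.ncard : ℝ)
            - ∏ k, (v k - u k)|}

/-- The generator matrix of the hexagonal lattice in the position of the magic angle. -/
def G₂ : Matrix (Fin 2) (Fin 2) ℝ :=
  !![(√3 - 1) / (2 * √2), -((√3 + 1) / (2 * √2));
     -((√3 + 1) / (2 * √2)), (√3 - 1) / (2 * √2)]

end RSPD

end

namespace RSPD

/-! Up to the factor `smallEntry`, the lattice consists of the points (a - ub, b - ua) with integers
a, b, where u = 2 + √3 is a unit of ℤ[√3] and u² = 4u - 1. Multiplication by u maps the lattice to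
itself and acts on the plane as diag(u, 1/u). A problem about long boxes can therefore be rescaled,
at constant area, to one about boxes of bounded width.

(ii) The product of the two coordinates is u times a nonzero integer (`fundUnit_le_abs_mul`), so a
small height difference forces a large horizontal one, and the width of the square limits the
latter. (iii) After rescaling, the width of the window lies in [1, u], where five explicit lattice
vectors suffice (`exists_gap`). (i) A strip of width 1 contains one lattice point for each
admissible b, hence has bounded counting error; by rescaling, so has every strip of width u^k. A box
inside a window of side L is cut into O(log L) such strips (`boxError_le_log`).

`IsDesign.exists_eq_image` reduces the design to all points of a translated lattice in the unit
square. This needs the margin ρ_c of the construction to cover δ, hence the lower bound for ρ_c. -/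

/-! ### The lattice and its multiplication by the unit -/

/-- The fundamental unit of `ℤ[√3]`. -/
noncomputable def fundUnit : ℝ := 2 + √3

/-- First coordinate of a point of the scaled hexagonal lattice. -/
noncomputable def coordX (f : ℤ × ℤ) : ℝ := f.1 - fundUnit * f.2

/-- Second coordinate of a point of the scaled hexagonal lattice. -/
noncomputable def coordY (f : ℤ × ℤ) : ℝ := f.2 - fundUnit * f.1

lemma fundUnit_sq : fundUnit ^ 2 = 4 * fundUnit - 1 := by
  have h : √3 ^ 2 = 3 := Real.sq_sqrt (by norm_num)
  unfold fundUnit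
  linear_combination h

lemma fundUnit_gt : 3.7 < fundUnit := by
  have : (1.7 : ℝ) < √3 := Real.lt_sqrt_of_sq_lt (by norm_num)
  unfold fundUnit
  linarith

lemma fundUnit_lt : fundUnit < 3.74 := by
  have : √3 < 1.74 := by
    rw [Real.sqrt_lt' (by norm_num)]
    norm_num
  unfold fundUnit
  linarith

lemma fundUnit_pos : 0 < fundUnit := by linarith [fundUnit_gt]

lemma irrational_fundUnit : Irrational fundUnit := by
  have h : Irrational (√3 : ℝ) := by
    simpa using Nat.Prime.irrational_sqrt (p := 3) (by norm_num)
  simpa [fundUnit] using h.ratCast_add 2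

/-- Multiplication by the fundamental unit, as a map of integer coordinates. -/
def unitEquiv : ℤ × ℤ ≃ ℤ × ℤ where
  toFun f := (f.2, 4 * f.2 - f.1)
  invFun f := (4 * f.1 - f.2, f.1)
  left_inv f := by ext <;> simp
  right_inv f := by ext <;> simp

lemma coordX_unitEquiv (f : ℤ × ℤ) : coordX (unitEquiv f) = fundUnit * coordX f := by
  simp only [coordX, unitEquiv, Equiv.coe_fn_mk]
  push_cast
  linear_combination (f.2 : ℝ) * fundUnit_sq

lemma coordY_unitEquiv (f : ℤ × ℤ) : fundUnit * coordY (unitEquiv f) = coordY f := by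
  simp only [coordY, unitEquiv, Equiv.coe_fn_mk]
  push_cast
  linear_combination -(f.2 : ℝ) * fundUnit_sq

lemma coordX_ne_zero {f : ℤ × ℤ} (hf : f ≠ 0) : coordX f ≠ 0 := by
  intro h
  unfold coordX at h
  by_cases h2 : f.2 = 0
  · have h1 : (f.1 : ℝ) = 0 := by simpa [h2] using h
    exact hf (Prod.ext (by exact_mod_cast h1) h2)
  · exact (irrational_fundUnit.mul_intCast h2).ne_int f.1 (by linarith)

lemma coordX_sub (f g : ℤ × ℤ) : coordX (f - g) = coordX f - coordX g := by
  simp only [coordX, Prod.fst_sub, Prod.snd_sub]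
  push_cast
  ring

lemma coordY_sub (f g : ℤ × ℤ) : coordY (f - g) = coordY f - coordY g := by
  simp only [coordY, Prod.fst_sub, Prod.snd_sub]
  push_cast
  ring

lemma coordX_add (f g : ℤ × ℤ) : coordX (f + g) = coordX f + coordX g := by
  simp only [coordX, Prod.fst_add, Prod.snd_add]
  push_cast
  ring

lemma coordY_add (f g : ℤ × ℤ) : coordY (f + g) = coordY f + coordY g := by
  simp only [coordY, Prod.fst_add, Prod.snd_add]
  push_cast
  ring

lemma coordX_injective : Function.Injective coordX := by
  intro f g h
  by_contra hne
  exact coordX_ne_zero (sub_ne_zero.2 hne) (by rw [coordX_sub, h, sub_self])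

/-- The product is u times the integral form 4ab - a² - b², which vanishes only at the origin
because u is irrational. -/
lemma fundUnit_le_abs_mul {f : ℤ × ℤ} (hf : f ≠ 0) : fundUnit ≤ |coordX f| * |coordY f| := by
  have hY : coordY f ≠ 0 := by
    have : f.swap ≠ 0 := fun h => hf (Prod.swap_injective (by simpa using h))
    simpa [coordX, coordY] using coordX_ne_zero this
  have key : coordX f * coordY f =
      fundUnit * ((4 * f.1 * f.2 - f.1 ^ 2 - f.2 ^ 2 : ℤ) : ℝ) := by
    simp only [coordX, coordY]
    push_cast
    linear_combination (f.1 * f.2 : ℝ) * fundUnit_sq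
  have hne : (4 * f.1 * f.2 - f.1 ^ 2 - f.2 ^ 2 : ℤ) ≠ 0 := by
    intro h
    rw [h] at key
    simp [coordX_ne_zero hf, hY] at key
  rw [← abs_mul, key, abs_mul, abs_of_pos fundUnit_pos]
  have : (1 : ℝ) ≤ |((4 * f.1 * f.2 - f.1 ^ 2 - f.2 ^ 2 : ℤ) : ℝ)| := by
    exact_mod_cast Int.one_le_abs hne
  nlinarith [fundUnit_pos]

/-! ### Gaps -/

lemma exists_gap_of_le_fundUnit {L t : ℝ} (h1 : 1 ≤ L) (hL : L ≤ fundUnit) (ht : 0 ≤ t)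
    (htL : t ≤ L) :
    ∃ f, 0 < coordY f ∧ L * coordY f ≤ 2 * fundUnit ^ 2 ∧ 0 ≤ t + coordX f ∧
      t + coordX f ≤ L := by
  have hsq := fundUnit_sq
  have hgt := fundUnit_gt
  have hlt := fundUnit_lt
  rcases le_or_gt 1 t with h | h
  · refine ⟨(-1, 0), ?_, ?_, ?_, ?_⟩ <;> simp only [coordX, coordY] <;> push_cast <;> nlinarith
  -- For t < 1, each range of L uses two vectors whose first coordinates differ by exactly 1. If the
  -- larger overshoots L, the smaller lands above L - 1 ≥ 0.
  rcases le_or_gt L (fundUnit - 2) with hL2 | hL2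
  · rcases le_or_gt t (L - (fundUnit - 3)) with h' | h'
    · refine ⟨(-3, -1), ?_, ?_, ?_, ?_⟩ <;> simp only [coordX, coordY] <;> push_cast <;> nlinarith
    · refine ⟨(-4, -1), ?_, ?_, ?_, ?_⟩ <;> simp only [coordX, coordY] <;> push_cast <;> nlinarith
  rcases le_or_gt L (fundUnit - 1) with hL3 | hL3
  · rcases le_or_gt t (L - (fundUnit - 2)) with h' | h'
    · refine ⟨(-2, -1), ?_, ?_, ?_, ?_⟩ <;> simp only [coordX, coordY] <;> push_cast <;> nlinarith
    -- This case fixes the constant: (u - 1)(3u - 1) = 2u².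
    · refine ⟨(-3, -1), ?_, ?_, ?_, ?_⟩ <;> simp only [coordX, coordY] <;> push_cast <;> nlinarith
  · rcases le_or_gt t (L - (fundUnit - 1)) with h' | h'
    · refine ⟨(-1, -1), ?_, ?_, ?_, ?_⟩ <;> simp only [coordX, coordY] <;> push_cast <;> nlinarith
    · refine ⟨(-2, -1), ?_, ?_, ?_, ?_⟩ <;> simp only [coordX, coordY] <;> push_cast <;> nlinarith

/-- The product L · `coordY f` is invariant when L is multiplied by u and f by the unit, so the
constant survives the induction. -/
lemma exists_gap_of_le_pow (k : ℕ) : ∀ {L t : ℝ}, fundUnit ^ k ≤ L → L ≤ fundUnit ^ (k + 1) →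
    0 ≤ t → t ≤ L →
    ∃ f, 0 < coordY f ∧ L * coordY f ≤ 2 * fundUnit ^ 2 ∧ 0 ≤ t + coordX f ∧
      t + coordX f ≤ L := by
  have hpos := fundUnit_pos
  induction k with
  | zero =>
    intro L t h1 h2 h3 h4
    exact exists_gap_of_le_fundUnit (by simpa using h1) (by simpa using h2) h3 h4
  | succ k ih =>
    intro L t h1 h2 h3 h4
    obtain ⟨f, hf1, hf2, hf3, hf4⟩ := ih (L := L / fundUnit) (t := t / fundUnit)
      (by rwa [le_div_iff₀ hpos, ← pow_succ]) (by rwa [div_le_iff₀ hpos, ← pow_succ])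
      (by positivity) (by gcongr)
    have hY := coordY_unitEquiv f
    have hX := coordX_unitEquiv f
    refine ⟨unitEquiv f, ?_, ?_, ?_, ?_⟩
    · exact pos_of_mul_pos_right (hY ▸ hf1) hpos.le
    · rw [← hY] at hf2
      convert hf2 using 1
      field_simp
    · have := mul_nonneg hpos.le hf3
      rw [mul_add, mul_div_cancel₀ _ hpos.ne'] at this
      rwa [hX]
    · have := mul_le_mul_of_nonneg_left hf4 hpos.le
      rw [mul_add, mul_div_cancel₀ _ hpos.ne', mul_div_cancel₀ _ hpos.ne'] at this
      rwa [hX]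

lemma exists_gap {L t : ℝ} (hL : 1 ≤ L) (ht : 0 ≤ t) (htL : t ≤ L) :
    ∃ f, 0 < coordY f ∧ L * coordY f ≤ 2 * fundUnit ^ 2 ∧ 0 ≤ t + coordX f ∧
      t + coordX f ≤ L := by
  obtain ⟨k, hk1, hk2⟩ := exists_nat_pow_near hL (by linarith [fundUnit_gt] : 1 < fundUnit)
  exact exists_gap_of_le_pow k hk1 hk2.le ht htL

/-! ### Counting lattice points in boxes -/

/-- The lattice points in the half-open box with corner `(c, d)` and side lengths `X`, `Y`. -/
def latticeBox (c X d Y : ℝ) : Set (ℤ × ℤ) :=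
  {f | (c ≤ coordX f ∧ coordX f < c + X) ∧ d ≤ coordY f ∧ coordY f < d + Y}

lemma covolume_pos : 0 < fundUnit ^ 2 - 1 := by nlinarith [fundUnit_gt]

lemma covolume_mul_snd (f : ℤ × ℤ) :
    (fundUnit ^ 2 - 1) * f.2 = -(coordY f + fundUnit * coordX f) := by
  simp only [coordX, coordY]
  ring

lemma covolume_mul_fst (f : ℤ × ℤ) :
    (fundUnit ^ 2 - 1) * f.1 = -(coordX f + fundUnit * coordY f) := by
  simp only [coordX, coordY]
  ring

lemma latticeBox_finite (c X d Y : ℝ) : (latticeBox c X d Y).Finite := by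
  have hc := covolume_pos
  have hp := fundUnit_pos
  refine ((Set.finite_Icc
    ⌈-(c + X + fundUnit * (d + Y)) / (fundUnit ^ 2 - 1)⌉
      ⌊-(c + fundUnit * d) / (fundUnit ^ 2 - 1)⌋).prod (Set.finite_Icc
    ⌈-(d + Y + fundUnit * (c + X)) / (fundUnit ^ 2 - 1)⌉
      ⌊-(d + fundUnit * c) / (fundUnit ^ 2 - 1)⌋)).subset ?_
  rintro f ⟨⟨h1, h2⟩, h3, h4⟩
  have e1 := covolume_mul_fst f
  have e2 := covolume_mul_snd f
  refine ⟨⟨?_, ?_⟩, ?_, ?_⟩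
  · rw [Int.ceil_le, div_le_iff₀ hc]
    nlinarith
  · rw [Int.le_floor, le_div_iff₀ hc]
    nlinarith
  · rw [Int.ceil_le, div_le_iff₀ hc]
    nlinarith
  · rw [Int.le_floor, le_div_iff₀ hc]
    nlinarith

/-- The deviation of the number of lattice points in a box from the expected number. -/
noncomputable def boxError (c X d Y : ℝ) : ℝ :=
  |((latticeBox c X d Y).ncard : ℝ) - X * Y / (fundUnit ^ 2 - 1)|

lemma ncard_latticeBox_scale (c X d Y : ℝ) :
    (latticeBox c X (fundUnit * d) (fundUnit * Y)).ncard =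
      (latticeBox (fundUnit * c) (fundUnit * X) d Y).ncard := by
  rw [← Set.ncard_image_of_injective _ unitEquiv.injective]
  congr 1
  ext g
  obtain ⟨f, rfl⟩ := unitEquiv.surjective g
  have hp := fundUnit_pos
  rw [unitEquiv.injective.mem_set_image]
  simp only [latticeBox, Set.mem_ofPred_eq, coordX_unitEquiv, ← coordY_unitEquiv f, ← mul_add,
    mul_le_mul_iff_right₀ hp, mul_lt_mul_iff_right₀ hp]

lemma boxError_scale (c X d Y : ℝ) :
    boxError c X (fundUnit * d) (fundUnit * Y) = boxError (fundUnit * c) (fundUnit * X) d Y := by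
  rw [boxError, boxError, ncard_latticeBox_scale]
  congr 3
  ring

lemma boxError_scale_pow (k : ℕ) (c X d Y : ℝ) :
    boxError c X (fundUnit ^ k * d) (fundUnit ^ k * Y) =
      boxError (fundUnit ^ k * c) (fundUnit ^ k * X) d Y := by
  induction k generalizing c X d Y with
  | zero => simp
  | succ k ih =>
    rw [pow_succ', mul_assoc, mul_assoc, boxError_scale, ih]
    congr 1 <;> ring

lemma latticeBox_mono {c X X' d Y : ℝ} (h : X ≤ X') : latticeBox c X d Y ⊆ latticeBox c X' d Y :=
  fun _ hf => ⟨⟨hf.1.1, by linarith [hf.1.2]⟩, hf.2⟩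

lemma ncard_latticeBox_add {c X X' d Y : ℝ} (hX : 0 ≤ X) (hX' : 0 ≤ X') :
    (latticeBox c (X + X') d Y).ncard =
      (latticeBox c X d Y).ncard + (latticeBox (c + X) X' d Y).ncard := by
  rw [← Set.ncard_union_eq _ (latticeBox_finite _ _ _ _) (latticeBox_finite _ _ _ _)]
  · congr 1
    ext f
    simp only [latticeBox, Set.mem_union, Set.mem_ofPred_eq]
    constructor
    · rintro ⟨⟨h1, h2⟩, h3⟩
      rcases lt_or_ge (coordX f) (c + X) with h | h
      · exact Or.inl ⟨⟨h1, h⟩, h3⟩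
      · exact Or.inr ⟨⟨h, by linarith⟩, h3⟩
    · rintro (⟨⟨h1, h2⟩, h3⟩ | ⟨⟨h1, h2⟩, h3⟩)
      · exact ⟨⟨h1, by linarith⟩, h3⟩
      · exact ⟨⟨by linarith, by linarith⟩, h3⟩
  · rw [Set.disjoint_left]
    intro f h h'
    linarith [h.1.2, h'.1.1]

lemma boxError_add_le {c X X' d Y : ℝ} (hX : 0 ≤ X) (hX' : 0 ≤ X') :
    boxError c (X + X') d Y ≤ boxError c X d Y + boxError (c + X) X' d Y := by
  simp only [boxError]
  rw [ncard_latticeBox_add hX hX']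
  refine le_trans (le_of_eq ?_) (abs_add_le _ _)
  congr 1
  push_cast
  ring

/-- In a strip of width 1 the second integer coordinate determines the first, so only the integers
in an interval of length (Y + u)/(u² - 1) are counted. -/
lemma ncard_latticeBox_one_le {c d Y : ℝ} (hY : 0 ≤ Y) :
    ((latticeBox c 1 d Y).ncard : ℝ) ≤ Y / (fundUnit ^ 2 - 1) + 2 := by
  have hc := covolume_pos
  have hp := fundUnit_pos
  set A : ℝ := -(d + Y + fundUnit * (c + 1)) / (fundUnit ^ 2 - 1) with hA
  set B : ℝ := -(d + fundUnit * c) / (fundUnit ^ 2 - 1) with hB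
  have hAB : B - A = (Y + fundUnit) / (fundUnit ^ 2 - 1) := by
    rw [hA, hB]
    field_simp
    ring
  have hinj : Set.InjOn Prod.snd (latticeBox c 1 d Y) := by
    rintro f ⟨⟨h1, h2⟩, -⟩ g ⟨⟨h3, h4⟩, -⟩ hfg
    refine Prod.ext ?_ hfg
    simp only [coordX] at h1 h2 h3 h4
    rw [hfg] at h1 h2
    have e1 : (f.1 : ℝ) < g.1 + 1 := by linarith
    have e2 : (g.1 : ℝ) < f.1 + 1 := by linarith
    norm_cast at e1 e2
    omega
  have hle : (latticeBox c 1 d Y).ncard ≤ (Finset.Icc ⌈A⌉ ⌊B⌋).card := by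
    rw [← Set.ncard_coe_finset]
    refine Set.ncard_le_ncard_of_injOn Prod.snd ?_ hinj (Finset.finite_toSet _)
    rintro f ⟨⟨h1, h2⟩, h3, h4⟩
    have e2 := covolume_mul_snd f
    rw [Finset.mem_coe, Finset.mem_Icc]
    constructor
    · rw [Int.ceil_le, div_le_iff₀ hc]
      nlinarith
    · rw [Int.le_floor, le_div_iff₀ hc]
      nlinarith
  have hcard : ((Finset.Icc ⌈A⌉ ⌊B⌋).card : ℝ) ≤ B - A + 1 := by
    rw [Int.card_Icc]
    have hnn : 0 ≤ B - A := by rw [hAB]; positivity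
    have : (((⌊B⌋ + 1 - ⌈A⌉).toNat : ℤ) : ℝ) ≤ B - A + 1 := by
      rw [Int.toNat_eq_max, Int.cast_max]
      apply max_le
      · push_cast
        linarith [Int.floor_le B, Int.le_ceil A]
      · push_cast
        linarith
    exact_mod_cast this
  have hsmall : fundUnit / (fundUnit ^ 2 - 1) ≤ 1 := by
    rw [div_le_one hc]
    nlinarith [fundUnit_gt]
  have : ((latticeBox c 1 d Y).ncard : ℝ) ≤ (Finset.Icc ⌈A⌉ ⌊B⌋).card := by exact_mod_cast hle
  rw [add_div] at hAB
  linarith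

lemma le_ncard_latticeBox_one {c d Y : ℝ} :
    Y / (fundUnit ^ 2 - 1) - 2 ≤ ((latticeBox c 1 d Y).ncard : ℝ) := by
  have hc := covolume_pos
  have hp := fundUnit_pos
  set A : ℝ := -(d + Y + fundUnit * c) / (fundUnit ^ 2 - 1) with hA
  set B : ℝ := -(d + fundUnit * (c + 1)) / (fundUnit ^ 2 - 1) with hB
  have hAB : B - A = (Y - fundUnit) / (fundUnit ^ 2 - 1) := by
    rw [hA, hB]
    field_simp
    ring
  -- Each integer in (A, B] has a lattice point in the strip, and its height is in range wherever in
  -- the strip it falls. The open end at A matches the strict upper bound on `coordY`.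
  have hle : (Finset.Ioc ⌊A⌋ ⌊B⌋).card ≤ (latticeBox c 1 d Y).ncard := by
    rw [← Set.ncard_coe_finset]
    refine Set.ncard_le_ncard_of_injOn (fun t : ℤ => (⌈c + fundUnit * t⌉, t)) ?_
      (fun s _ t _ h => congrArg Prod.snd h) (latticeBox_finite _ _ _ _)
    intro t ht
    rw [Finset.mem_coe, Finset.mem_Ioc, Int.floor_lt, Int.le_floor, hA, hB, div_lt_iff₀ hc,
      le_div_iff₀ hc] at ht
    have e2 := covolume_mul_snd (⌈c + fundUnit * t⌉, t)
    have h1 := Int.le_ceil (c + fundUnit * t)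
    have h2 := Int.ceil_lt_add_one (c + fundUnit * t)
    have hx1 : c ≤ coordX (⌈c + fundUnit * t⌉, t) := by
      simp only [coordX]
      linarith
    have hx2 : coordX (⌈c + fundUnit * t⌉, t) < c + 1 := by
      simp only [coordX]
      linarith
    simp only at e2
    refine ⟨⟨hx1, hx2⟩, ?_, ?_⟩ <;> nlinarith
  have hcard : B - A - 1 ≤ ((Finset.Ioc ⌊A⌋ ⌊B⌋).card : ℝ) := by
    rw [Int.card_Ioc]
    have : B - A - 1 ≤ (((⌊B⌋ - ⌊A⌋).toNat : ℤ) : ℝ) := by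
      rw [Int.toNat_eq_max, Int.cast_max]
      refine le_max_of_le_left ?_
      push_cast
      linarith [Int.lt_floor_add_one B, Int.floor_le A]
    exact_mod_cast this
  have hsmall : fundUnit / (fundUnit ^ 2 - 1) ≤ 1 := by
    rw [div_le_one hc]
    nlinarith [fundUnit_gt]
  have : ((Finset.Ioc ⌊A⌋ ⌊B⌋).card : ℝ) ≤ (latticeBox c 1 d Y).ncard := by exact_mod_cast hle
  rw [sub_div] at hAB
  linarith

lemma boxError_one_le {c d Y : ℝ} (hY : 0 ≤ Y) : boxError c 1 d Y ≤ 2 := by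
  rw [boxError, abs_le, one_mul]
  constructor
  · linarith [le_ncard_latticeBox_one (c := c) (d := d) (Y := Y)]
  · linarith [ncard_latticeBox_one_le (c := c) (d := d) hY]

lemma boxError_pow_le (k : ℕ) {c d Y : ℝ} (hY : 0 ≤ Y) : boxError c (fundUnit ^ k) d Y ≤ 2 := by
  have hk : 0 < fundUnit ^ k := pow_pos fundUnit_pos k
  have h := boxError_scale_pow k (c / fundUnit ^ k) 1 d Y
  rw [mul_div_cancel₀ _ hk.ne', mul_one] at h
  rw [← h]
  exact boxError_one_le (by positivity)

/-- Strips of width w are cut off one at a time, each costing 2; K pays for the remainder. -/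
lemma boxError_nat_mul_add_le {w K d Y : ℝ} (hw : 0 ≤ w) (hw2 : ∀ c, boxError c w d Y ≤ 2)
    (hK : ∀ c X, 0 ≤ X → X ≤ w → boxError c X d Y ≤ K) (j : ℕ) :
    ∀ c X, 0 ≤ X → X ≤ (j + 1) * w → boxError c X d Y ≤ 2 * j + K := by
  induction j with
  | zero =>
    intro c X h0 h
    simpa using hK c X h0 (by simpa using h)
  | succ j ih =>
    intro c X h0 h
    push_cast at h ⊢
    rcases le_or_gt X w with hX | hX
    · linarith [hK c X h0 hX, (Nat.cast_nonneg j : (0 : ℝ) ≤ j)]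
    · have h1 := boxError_add_le (c := c) (d := d) (Y := Y) hw (sub_nonneg.2 hX.le)
      rw [add_sub_cancel] at h1
      linarith [hw2 c, ih (c + w) (X - w) (by linarith) (by linarith)]

lemma boxError_le_of_le_pow {d Y : ℝ} (hY : 0 ≤ Y) (hY1 : Y ≤ 1) (m : ℕ) :
    ∀ c X, 0 ≤ X → X ≤ fundUnit ^ m → boxError c X d Y ≤ 6 * m + 3 := by
  have hc := covolume_pos
  induction m with
  | zero =>
    intro c X h0 h
    rw [pow_zero] at h
    have hYle : Y / (fundUnit ^ 2 - 1) ≤ 1 := by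
      rw [div_le_one hc]
      nlinarith [fundUnit_gt]
    have h1 := ncard_latticeBox_one_le (c := c) (d := d) hY
    have h2 : ((latticeBox c X d Y).ncard : ℝ) ≤ (latticeBox c 1 d Y).ncard := by
      exact_mod_cast Set.ncard_le_ncard (latticeBox_mono h) (latticeBox_finite _ _ _ _)
    have h3 : X * Y / (fundUnit ^ 2 - 1) ≤ Y / (fundUnit ^ 2 - 1) := by
      gcongr
      nlinarith
    have h4 : 0 ≤ X * Y / (fundUnit ^ 2 - 1) := by positivity
    have h5 : (0 : ℝ) ≤ (latticeBox c X d Y).ncard := Nat.cast_nonneg _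
    rw [boxError, abs_le]
    constructor <;> push_cast <;> linarith
  | succ m ih =>
    intro c X h0 h
    have hm : 0 < fundUnit ^ m := pow_pos fundUnit_pos m
    -- Since u < 4, three strips of width u^m and a remainder suffice.
    have := boxError_nat_mul_add_le hm.le (fun c => boxError_pow_le m hY) ih 3 c X
      h0 (by
        rw [pow_succ] at h
        push_cast
        nlinarith [fundUnit_lt])
    push_cast at this ⊢
    linarith

/-- Boxes inside a window with sides at most `L` have deviation `O(log L)`. -/
lemma boxError_le_log {L : ℝ} (hL : 1 ≤ L) {c X d Y : ℝ} (hX : 0 ≤ X) (hXL : X ≤ L) (hY : 0 ≤ Y)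
    (hYL : Y ≤ L) : boxError c X d Y ≤ 12 * Real.log L + 15 := by
  have hu1 : 1 < fundUnit := by linarith [fundUnit_gt]
  obtain ⟨k, hk1, hk2⟩ := exists_nat_pow_near hL hu1
  have hk : 0 < fundUnit ^ (k + 1) := pow_pos fundUnit_pos _
  have h := boxError_scale_pow (k + 1) c X (d / fundUnit ^ (k + 1)) (Y / fundUnit ^ (k + 1))
  rw [mul_div_cancel₀ _ hk.ne', mul_div_cancel₀ _ hk.ne'] at h
  -- Rescaling by u^(k+1) > L brings the height below 1 and the width to at most u^(2(k+1)).
  have hb := boxError_le_of_le_pow (d := d / fundUnit ^ (k + 1)) (Y := Y / fundUnit ^ (k + 1))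
    (by positivity) (by rw [div_le_one hk]; linarith) (2 * (k + 1))
    (fundUnit ^ (k + 1) * c) (fundUnit ^ (k + 1) * X) (by positivity)
    (by
      rw [two_mul, pow_add _ (k + 1)]
      exact mul_le_mul_of_nonneg_left (hXL.trans hk2.le) hk.le)
  have hlog : (k : ℝ) ≤ Real.log L := by
    have h1 : (1 : ℝ) ≤ Real.log fundUnit := by
      rw [Real.le_log_iff_exp_le fundUnit_pos]
      linarith [Real.exp_one_lt_d9, fundUnit_gt]
    have h2 := Real.log_le_log (pow_pos fundUnit_pos k) hk1
    rw [Real.log_pow] at h2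
    nlinarith [(Nat.cast_nonneg k : (0 : ℝ) ≤ k)]
  rw [h]
  push_cast at hb
  linarith

/-! ### Covering radius and scale of the hexagonal lattice -/

/-- The smaller entry of the generator matrix in absolute value. -/
noncomputable def smallEntry : ℝ := (√3 - 1) / (2 * √2)

lemma smallEntry_pos : 0 < smallEntry := by
  have : (1 : ℝ) < √3 := Real.lt_sqrt_of_sq_lt (by norm_num)
  exact div_pos (by linarith) (by positivity)

lemma smallEntry_sq : smallEntry ^ 2 = (2 - √3) / 4 := by
  have h3 : √3 ^ 2 = 3 := Real.sq_sqrt (by norm_num)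
  have h2 : √2 ^ 2 = 2 := Real.sq_sqrt (by norm_num)
  rw [smallEntry, div_pow, mul_pow, h2]
  linear_combination h3 / 8

lemma fundUnit_mul_smallEntry : fundUnit * smallEntry = (√3 + 1) / (2 * √2) := by
  have h3 : √3 ^ 2 = 3 := Real.sq_sqrt (by norm_num)
  rw [smallEntry, fundUnit, ← mul_div_assoc]
  congr 1
  linear_combination h3

lemma smallEntry_sq_mul : smallEntry ^ 2 * fundUnit = 1 / 4 := by
  have h3 : √3 ^ 2 = 3 := Real.sq_sqrt (by norm_num)
  rw [smallEntry_sq, fundUnit]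
  linear_combination -h3 / 4

lemma smallEntry_sq_mul_sq : smallEntry ^ 2 * fundUnit ^ 2 = (2 + √3) / 4 := by
  rw [pow_two fundUnit, ← mul_assoc, smallEntry_sq_mul, fundUnit]
  ring

lemma G₂_eq : G₂ = !![smallEntry, -(fundUnit * smallEntry);
    -(fundUnit * smallEntry), smallEntry] := by
  rw [fundUnit_mul_smallEntry]
  rfl

lemma latticePoint_G₂ (f : Fin 2 → ℤ) :
    latticePoint G₂ f = ![smallEntry * coordX (f 0, f 1), smallEntry * coordY (f 0, f 1)] := by
  rw [G₂_eq]
  ext k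
  fin_cases k <;>
    simp [latticePoint, Matrix.vecMul, dotProduct, Fin.sum_univ_two, coordX, coordY] <;> ring

lemma eDist_le_eDist_iff (x y z : Fin 2 → ℝ) :
    eDist x y ≤ eDist x z ↔
      (x 0 - y 0) ^ 2 + (x 1 - y 1) ^ 2 ≤ (x 0 - z 0) ^ 2 + (x 1 - z 1) ^ 2 := by
  simp only [eDist, EuclideanSpace.dist_eq, Fin.sum_univ_two, Real.dist_eq, sq_abs]
  exact Real.sqrt_le_sqrt_iff (by positivity)

lemma eDist_zero (x : Fin 2 → ℝ) : eDist x 0 = √(x 0 ^ 2 + x 1 ^ 2) := by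
  simp [eDist, EuclideanSpace.norm_eq, Fin.sum_univ_two]

lemma mem_voronoiCell_zero {E : Set (Fin 2 → ℝ)} {x : Fin 2 → ℝ} :
    x ∈ voronoiCell E 0 ↔ ∀ y ∈ E, 2 * (x 0 * y 0 + x 1 * y 1) ≤ y 0 ^ 2 + y 1 ^ 2 := by
  refine forall₂_congr fun y _ => ?_
  rw [eDist_le_eDist_iff]
  simp only [Pi.zero_apply, sub_zero]
  constructor <;> intro h <;> nlinarith

lemma sq_add_sq_latticePoint (f : Fin 2 → ℤ) :
    latticePoint G₂ f 0 ^ 2 + latticePoint G₂ f 1 ^ 2 =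
      (f 0 : ℝ) ^ 2 - f 0 * f 1 + (f 1 : ℝ) ^ 2 := by
  simp only [latticePoint_G₂, Matrix.cons_val_zero, Matrix.cons_val_one, coordX, coordY]
  linear_combination ((f 0 : ℝ) ^ 2 + f 1 ^ 2) * (smallEntry_sq + smallEntry_sq_mul_sq)
    - 4 * (f 0 : ℝ) * f 1 * smallEntry_sq_mul

/-- The six minimal vectors already cut out a hexagon of circumradius 1/√3, so a finite E containing
them is enough. -/
lemma sq_add_sq_le_of_mem_voronoiCell {E : Set (Fin 2 → ℝ)}
    (hE : ∀ f : Fin 2 → ℤ, (f 0 : ℝ) ^ 2 - f 0 * f 1 + (f 1 : ℝ) ^ 2 ≤ 1 → latticePoint G₂ f ∈ E)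
    {x : Fin 2 → ℝ} (hx : x ∈ voronoiCell E 0) : x 0 ^ 2 + x 1 ^ 2 ≤ 1 / 3 := by
  rw [mem_voronoiCell_zero] at hx
  set α := smallEntry * x 0 - fundUnit * smallEntry * x 1 with hα
  set β := -(fundUnit * smallEntry) * x 0 + smallEntry * x 1 with hβ
  have key : ∀ i j : ℤ, (i : ℝ) ^ 2 - i * j + (j : ℝ) ^ 2 = 1 → 2 * (i * α + j * β) ≤ 1 := by
    intro i j hij
    have h := hx _ (hE ![i, j] (by simpa using hij.le))
    rw [sq_add_sq_latticePoint] at h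
    simp only [latticePoint_G₂, Matrix.cons_val_zero, Matrix.cons_val_one, coordX, coordY,
      hij] at h
    rw [hα, hβ]
    linarith
  have h1 := key 1 0 (by norm_num)
  have h2 := key (-1) 0 (by norm_num)
  have h3 := key 0 1 (by norm_num)
  have h4 := key 0 (-1) (by norm_num)
  have h5 := key 1 1 (by norm_num)
  have h6 := key (-1) (-1) (by norm_num)
  push_cast at h1 h2 h3 h4 h5 h6
  have hform : α ^ 2 + α * β + β ^ 2 = 3 / 4 * (x 0 ^ 2 + x 1 ^ 2) := by
    rw [hα, hβ]
    linear_combination (x 0 ^ 2 + x 1 ^ 2 + x 0 * x 1) * (smallEntry_sq + smallEntry_sq_mul_sq)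
      - (x 0 ^ 2 + x 1 ^ 2 + 4 * x 0 * x 1) * smallEntry_sq_mul
  -- Here |α|, |β| and |α + β| are at most 1/2. The form is at most (α + β)² for equal signs and at
  -- most max(α², β²) for opposite signs.
  have hle : α ^ 2 + α * β + β ^ 2 ≤ 1 / 4 := by
    rcases le_total 0 α with ha | ha <;> rcases le_total 0 β with hb | hb <;>
      rcases le_total 0 (α + β) with hab | hab <;> nlinarith
  linarith

/-- A deep hole of the hexagonal lattice. -/
noncomputable def deepHole : Fin 2 → ℝ :=
  ![(2 - fundUnit) * smallEntry / 3, (1 - 2 * fundUnit) * smallEntry / 3]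

/-- The hole is the centroid of the triangle formed by the origin, the first generator and the sum
of both generators. -/
lemma deepHole_inner (f : Fin 2 → ℤ) :
    2 * (deepHole 0 * latticePoint G₂ f 0 + deepHole 1 * latticePoint G₂ f 1) = f 0 := by
  simp only [latticePoint_G₂, deepHole, Matrix.cons_val_zero, Matrix.cons_val_one, coordX, coordY]
  linear_combination (4 * f 0 + 2 * f 1 : ℝ) / 3 * (smallEntry_sq + smallEntry_sq_mul_sq)
    - (8 * f 1 + 4 * f 0 : ℝ) / 3 * smallEntry_sq_mul

lemma deepHole_sq : deepHole 0 ^ 2 + deepHole 1 ^ 2 = 1 / 3 := by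
  simp only [deepHole, Matrix.cons_val_zero, Matrix.cons_val_one]
  linear_combination 5 / 9 * (smallEntry_sq + smallEntry_sq_mul_sq) - 8 / 9 * smallEntry_sq_mul

lemma deepHole_mem : deepHole ∈ voronoiCell (lattice G₂) 0 := by
  rw [mem_voronoiCell_zero]
  rintro _ ⟨f, rfl⟩
  rw [sq_add_sq_latticePoint, deepHole_inner]
  have : f 0 ≤ f 0 ^ 2 - f 0 * f 1 + f 1 ^ 2 := by
    by_contra! h
    have h0 : f 0 = 1 := by nlinarith [sq_nonneg (2 * f 1 - f 0)]
    rw [h0] at h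
    nlinarith [Int.le_self_sq (f 1)]
  exact_mod_cast this

lemma deepHole_mem_frontier : deepHole ∈ frontier (voronoiCell (lattice G₂) 0) := by
  refine ⟨subset_closure deepHole_mem, fun h => ?_⟩
  rw [mem_interior_iff_mem_nhds] at h
  have hc : Filter.Tendsto (fun t : ℝ => (1 + t) • deepHole) (nhdsWithin 0 (Set.Ioi 0))
      (nhds deepHole) := by
    have : Continuous (fun t : ℝ => (1 + t) • deepHole) := by fun_prop
    simpa using (this.tendsto 0).mono_left nhdsWithin_le_nhds
  -- A slight outward dilation violates the cell inequality for the first generator.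
  obtain ⟨t, ht, ht0⟩ :=
    ((hc.eventually_mem h).and (eventually_mem_nhdsWithin (s := Set.Ioi (0 : ℝ)))).exists
  have h1 := mem_voronoiCell_zero.1 ht (latticePoint G₂ ![1, 0]) (Set.mem_range_self _)
  have h2 := deepHole_inner ![1, 0]
  rw [sq_add_sq_latticePoint] at h1
  simp only [Pi.smul_apply, smul_eq_mul, Matrix.cons_val_zero, Matrix.cons_val_one] at h1 h2
  push_cast at h1 h2
  have ht0' : 0 < t := ht0
  nlinarith

lemma le_coveringRadius : √(1 / 3) ≤ coveringRadius G₂ := by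
  have hcl : closure (voronoiCell (lattice G₂) 0) ⊆ {x : Fin 2 → ℝ | x 0 ^ 2 + x 1 ^ 2 ≤ 1 / 3} :=
    closure_minimal (fun x hx =>
      sq_add_sq_le_of_mem_voronoiCell (E := lattice G₂) (fun f _ => ⟨f, rfl⟩) hx)
      (isClosed_le (by fun_prop) continuous_const)
  refine le_csSup ⟨√(1 / 3), ?_⟩ ⟨deepHole, deepHole_mem_frontier, ?_⟩
  · rintro _ ⟨x, hx, rfl⟩
    simp only [eDist_zero]
    exact Real.sqrt_le_sqrt (hcl hx.1)
  · simp only [eDist_zero, deepHole_sq]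

lemma unitBallVolume_two : unitBallVolume 2 = Real.pi := by
  simp [unitBallVolume, one_add_one_eq_two]

lemma abs_det_G₂ : |G₂.det| = √3 / 2 := by
  have : G₂.det = -(√3 / 2) := by
    rw [G₂_eq, Matrix.det_fin_two_of]
    linear_combination smallEntry_sq - smallEntry_sq_mul_sq
  rw [this, abs_neg, abs_of_nonneg (by positivity)]

/-- The covering radius cancels, so its exact value is not needed. -/
lemma scale_G₂ (n : ℕ) : scale n G₂ = √(n * (√3 / 2)) := by
  have hρ : 0 < coveringRadius G₂ :=
    lt_of_lt_of_le (Real.sqrt_pos.2 (by norm_num)) le_coveringRadius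
  rw [scale, thickness, unitBallVolume_two, abs_det_G₂]
  have : (n : ℝ) * Real.pi / (Real.pi * coveringRadius G₂ ^ 2 / (√3 / 2)) =
      n * (√3 / 2) / coveringRadius G₂ ^ 2 := by
    have := Real.pi_pos
    field_simp
  rw [this, Nat.cast_ofNat, ← Real.sqrt_eq_rpow, Real.sqrt_div (by positivity),
    Real.sqrt_sq hρ.le, div_mul_cancel₀ _ hρ.ne']

/-! ### Designs as translated lattices in the unit square -/

/-- An affine image of the scaled hexagonal lattice. -/
noncomputable def designPoint (s : ℝ) (o : Fin 2 → ℝ) (f : ℤ × ℤ) : Fin 2 → ℝ :=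
  ![s * coordX f + o 0, s * coordY f + o 1]

lemma designPoint_injective {s : ℝ} (hs : s ≠ 0) (o : Fin 2 → ℝ) :
    Function.Injective (designPoint s o) := by
  intro f g h
  have h0 := congrFun h 0
  simp only [designPoint, Matrix.cons_val_zero, add_left_inj] at h0
  exact coordX_injective (mul_left_cancel₀ hs h0)

/-- A design consists of all points of a translate of the scaled lattice in the unit square. -/
lemma IsDesign.exists_eq_image {n : ℕ} {D : Set (Fin 2 → ℝ)} (hn : 2 ≤ n)
    (hD : IsDesign n G₂ 1 D) :
    ∃ (s : ℝ) (o : Fin 2 → ℝ), 0 < s ∧ s ^ 2 * (n * (fundUnit ^ 2 - 1)) = 1 ∧ D.ncard = n ∧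
      D = designPoint s o '' {f | ∀ k, designPoint s o f k ∈ Set.Icc (0 : ℝ) 1} := by
  obtain ⟨F, δ, hF, ⟨hδ, hcard⟩, rfl⟩ := hD
  have hρ := le_coveringRadius
  have hl := scale_G₂ n
  rw [SufficientlyLarge, mul_one] at hF
  rw [largeDesign, mul_one] at hF hδ hcard
  rw [extracted, largeDesign, mul_one]
  generalize coveringRadius G₂ = ρ at *
  generalize scale n G₂ = l at *
  have h3 : (1.7 : ℝ) < √3 := Real.lt_sqrt_of_sq_lt (by norm_num)
  have hn2 : (2 : ℝ) ≤ n := by exact_mod_cast hn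
  have hl1 : 1.3 ≤ l := by
    rw [hl]
    apply Real.le_sqrt_of_sq_le
    nlinarith
  have hl0 : 0 < l := by linarith
  have hl2 : l ^ 2 = n * (√3 / 2) := by rw [hl]; exact Real.sq_sqrt (by positivity)
  have hρ1 : 0.5 ≤ ρ := le_trans (Real.le_sqrt_of_sq_le (by norm_num)) hρ
  have hρ2 : 1 / 3 ≤ ρ ^ 2 := by
    rw [← Real.sq_sqrt (show (0 : ℝ) ≤ 1 / 3 by norm_num)]
    gcongr
  have hbound : δ 0 ^ 2 + δ 1 ^ 2 ≤ 1 / 3 := by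
    -- The half-side l/2 + ρ exceeds 1, so E contains all minimal vectors.
    refine sq_add_sq_le_of_mem_voronoiCell (fun f hf => hF ⟨⟨f, rfl⟩, ?_⟩) hδ
    rw [← sq_add_sq_latticePoint] at hf
    have h0 := abs_le.1 (abs_le_one_iff_mul_self_le_one.2
      (show latticePoint G₂ f 0 * latticePoint G₂ f 0 ≤ 1 by
        nlinarith [sq_nonneg (latticePoint G₂ f 1)]))
    have h1 := abs_le.1 (abs_le_one_iff_mul_self_le_one.2
      (show latticePoint G₂ f 1 * latticePoint G₂ f 1 ≤ 1 by
        nlinarith [sq_nonneg (latticePoint G₂ f 0)]))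
    simp only [Set.mem_ofPred_eq, Fin.forall_fin_two, Set.mem_Icc]
    refine ⟨⟨?_, ?_⟩, ?_, ?_⟩ <;> linarith
  have hδ0 : ∀ k, |δ k| ≤ ρ := by
    rw [Fin.forall_fin_two]
    constructor <;> refine abs_le_of_sq_le_sq ?_ (by linarith) <;>
      nlinarith [sq_nonneg (δ 0), sq_nonneg (δ 1)]
  set g : (Fin 2 → ℝ) → Fin 2 → ℝ := fun x k => (x k + δ k) / l + 1 / 2 with hg
  have hwin : ∀ x : Fin 2 → ℝ, (∀ k, g x k ∈ Set.Icc (0 : ℝ) 1) ↔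
      ∀ k, x k ∈ Set.Icc (-(l / 2) - δ k) (l / 2 - δ k) := by
    intro x
    refine forall_congr' fun k => ?_
    simp only [hg, Set.mem_Icc]
    have e : (x k + δ k) / l * l = x k + δ k := div_mul_cancel₀ _ hl0.ne'
    constructor
    · rintro ⟨h1, h2⟩
      constructor <;> nlinarith
    · rintro ⟨h1, h2⟩
      have : -(1 / 2) ≤ (x k + δ k) / l := by rw [le_div_iff₀ hl0]; linarith
      have : (x k + δ k) / l ≤ 1 / 2 := by rw [div_le_iff₀ hl0]; linarith
      constructor <;> linarith
  have hginj : Function.Injective g := by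
    intro x y h
    funext k
    have := congrFun h k
    simp only [hg, add_left_inj] at this
    rw [div_left_inj' hl0.ne'] at this
    linarith
  have hpoint : ∀ f : Fin 2 → ℤ, g (latticePoint G₂ f) =
      designPoint (smallEntry / l) (fun k => δ k / l + 1 / 2) (f 0, f 1) := by
    intro f
    ext k
    fin_cases k <;> simp [hg, designPoint, latticePoint_G₂] <;> ring
  refine ⟨smallEntry / l, fun k => δ k / l + 1 / 2, div_pos smallEntry_pos hl0, ?_, ?_, ?_⟩
  · rw [div_pow, hl2, div_mul_eq_mul_div, div_eq_one_iff_eq (by positivity)]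
    linear_combination (n : ℝ) * (smallEntry_sq_mul_sq - smallEntry_sq)
  · rw [← Set.image_inter_preimage, Set.ncard_image_of_injective _ hginj, ← hcard]
    congr 1
    ext x
    simp only [Set.mem_inter_iff, Set.mem_preimage, Set.mem_ofPred_eq, hwin]
  · ext p
    constructor
    · rintro ⟨⟨_, ⟨f, -, rfl⟩, rfl⟩, hp⟩
      refine ⟨(f 0, f 1), ?_, (hpoint f).symm⟩
      rw [Set.mem_ofPred_eq, ← hpoint f]
      exact hp
    · rintro ⟨f, hf, rfl⟩
      have e : designPoint (smallEntry / l) (fun k => δ k / l + 1 / 2) f =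
          g (latticePoint G₂ ![f.1, f.2]) := by
        rw [hpoint]
        rfl
      rw [Set.mem_ofPred_eq, e] at hf
      rw [e]
      refine ⟨⟨_, hF ⟨⟨_, rfl⟩, fun k => ?_⟩, rfl⟩, hf⟩
      have h1 := (hwin _).1 hf k
      have h2 := abs_le.1 (hδ0 k)
      constructor <;> linarith [h1.1, h1.2]

/-! ### Discrepancy, separation and gaps of the design -/

lemma fundUnit_sq_sub_one : fundUnit ^ 2 - 1 = 2 * √3 * fundUnit := by
  have h3 : √3 ^ 2 = 3 := Real.sq_sqrt (by norm_num)
  rw [fundUnit]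
  linear_combination -h3

/-- The part of a translate of the scaled lattice in a half-open box, as a lattice box. -/
lemma designPoint_mem_box_iff {s : ℝ} (hs : 0 < s) (o u v : Fin 2 → ℝ) (f : ℤ × ℤ) :
    (∀ k, u k ≤ designPoint s o f k ∧ designPoint s o f k < v k) ↔
      f ∈ latticeBox ((u 0 - o 0) / s) ((v 0 - u 0) / s) ((u 1 - o 1) / s)
        ((v 1 - u 1) / s) := by
  rw [Fin.forall_fin_two]
  simp only [designPoint, Matrix.cons_val_zero, Matrix.cons_val_one, latticeBox,
    Set.mem_ofPred_eq, ← add_div, div_le_iff₀ hs, lt_div_iff₀ hs]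
  constructor
  · rintro ⟨⟨h1, h2⟩, h3, h4⟩
    refine ⟨⟨?_, ?_⟩, ?_, ?_⟩ <;> linarith
  · rintro ⟨⟨h1, h2⟩, h3, h4⟩
    refine ⟨⟨?_, ?_⟩, ?_, ?_⟩ <;> linarith

lemma le_one_of_sq_mul_eq_one {s : ℝ} (hs : 0 < s) {n : ℕ} (hn : 2 ≤ n)
    (h : s ^ 2 * (n * (fundUnit ^ 2 - 1)) = 1) : s ≤ 1 := by
  have hn2 : (2 : ℝ) ≤ n := by exact_mod_cast hn
  have h2 : 1 ≤ fundUnit ^ 2 - 1 := by nlinarith [fundUnit_gt]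
  have h1 : 1 ≤ (n : ℝ) * (fundUnit ^ 2 - 1) := by nlinarith
  by_contra! hs1
  nlinarith

lemma extremeDiscrepancy_le {n : ℕ} {D : Set (Fin 2 → ℝ)} (hn : 2 ≤ n)
    (hD : IsDesign n G₂ 1 D) : extremeDiscrepancy D ≤ 60 * (Real.log n / n) := by
  obtain ⟨s, o, hs, hsn, hcard, hDeq⟩ := hD.exists_eq_image hn
  have hn2 : (2 : ℝ) ≤ n := by exact_mod_cast hn
  have hn0 : (0 : ℝ) < n := by linarith
  have hs1 := le_one_of_sq_mul_eq_one hs hn hsn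
  have hcov := covolume_pos
  have hlogn : Real.log 2 ≤ Real.log n := Real.log_le_log (by norm_num) hn2
  have hlog2 := Real.log_two_gt_d9
  have hL : Real.log (1 / s) ≤ (Real.log n + 4 * Real.log 2) / 2 := by
    -- The covolume u² - 1 is below 16; the resulting constant terms are absorbed using log n ≥ log
    -- 2.
    have h1 : (1 / s) ^ 2 ≤ n * 2 ^ 4 := by
      have : (1 / s) ^ 2 = n * (fundUnit ^ 2 - 1) := by
        rw [div_pow, one_pow, div_eq_iff (by positivity), mul_comm]
        exact hsn.symm
      rw [this]
      gcongr
      nlinarith [fundUnit_lt, fundUnit_pos]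
    have h2 := Real.log_le_log (by positivity) h1
    rw [Real.log_pow, Real.log_mul hn0.ne' (by norm_num), Real.log_pow] at h2
    push_cast at h2
    linarith
  refine Real.sSup_le ?_ (mul_nonneg (by norm_num) (div_nonneg (by linarith) hn0.le))
  rintro _ ⟨u, v, hu, hv, huv, rfl⟩
  have hcount : (D ∩ {x | ∀ k, u k ≤ x k ∧ x k < v k}).ncard =
      (latticeBox ((u 0 - o 0) / s) ((v 0 - u 0) / s) ((u 1 - o 1) / s)
        ((v 1 - u 1) / s)).ncard := by
    rw [← Set.ncard_image_of_injective _ (designPoint_injective hs.ne' o), hDeq,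
      ← Set.image_inter_preimage]
    congr 2
    ext f
    rw [← designPoint_mem_box_iff hs, Set.mem_inter_iff, Set.mem_preimage]
    refine ⟨fun h => h.2, fun h => ⟨fun k => ⟨?_, ?_⟩, h⟩⟩
    · linarith [(hu k).1, (h k).1]
    · linarith [(hv k).2, (h k).2]
  have hside : ∀ k, 0 ≤ (v k - u k) / s ∧ (v k - u k) / s ≤ 1 / s := fun k =>
    ⟨div_nonneg (by linarith [huv k]) hs.le, by gcongr; linarith [(hu k).1, (hv k).2]⟩
  have herr := boxError_le_log (L := 1 / s) (by rw [le_div_iff₀ hs]; linarith)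
    (c := (u 0 - o 0) / s) (d := (u 1 - o 1) / s) (hside 0).1 (hside 0).2 (hside 1).1 (hside 1).2
  rw [boxError, ← hcount] at herr
  have harea : (v 0 - u 0) / s * ((v 1 - u 1) / s) / (fundUnit ^ 2 - 1) =
      n * ∏ k, (v k - u k) := by
    rw [Fin.prod_univ_two]
    field_simp
    linear_combination -((v 0 - u 0) * (v 1 - u 1)) * hsn
  rw [harea] at herr
  rw [hcard, ← mul_div_assoc, le_div_iff₀ hn0, ← abs_of_pos hn0, ← abs_mul, abs_of_pos hn0,
    sub_mul, div_mul_cancel₀ _ hn0.ne', mul_comm (∏ k, (v k - u k))]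
  linarith

lemma le_abs_sub_of_mem {n : ℕ} {D : Set (Fin 2 → ℝ)} (hn : 2 ≤ n) (hD : IsDesign n G₂ 1 D)
    {x y : Fin 2 → ℝ} (hx : x ∈ D) (hy : y ∈ D) (hxy : x ≠ y) : √3 / 6 / n ≤ |x 1 - y 1| := by
  obtain ⟨s, o, hs, hsn, -, rfl⟩ := hD.exists_eq_image hn
  obtain ⟨f, hf, rfl⟩ := hx
  obtain ⟨g, hg, rfl⟩ := hy
  have hn0 : (0 : ℝ) < n := by positivity
  have hne : f - g ≠ 0 := sub_ne_zero.2 fun h => hxy (by rw [h])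
  have h0 := fundUnit_le_abs_mul hne
  have hf0 := hf 0
  have hg0 := hg 0
  simp only [designPoint, Matrix.cons_val_zero, Matrix.cons_val_one, Set.mem_Icc] at hf0 hg0 ⊢
  have hX : s * |coordX (f - g)| ≤ 1 := by
    have : |s * coordX (f - g)| ≤ 1 := by
      rw [coordX_sub, abs_le]
      constructor <;> linarith [hf0.1, hf0.2, hg0.1, hg0.2]
    rwa [abs_mul, abs_of_pos hs] at this
  have hY : |s * coordY f + o 1 - (s * coordY g + o 1)| = s * |coordY (f - g)| := by
    rw [add_sub_add_right_eq_sub, ← mul_sub, ← coordY_sub, abs_mul, abs_of_pos hs]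
  have h3 : √3 * √3 = 3 := Real.mul_self_sqrt (by norm_num)
  -- From s²n(u² - 1) = 1 and u² - 1 = 2√3u.
  have hsu : √3 / 6 / n = s ^ 2 * fundUnit := by
    rw [fundUnit_sq_sub_one] at hsn
    rw [div_eq_iff hn0.ne']
    linear_combination (-√3 / 6) * hsn + s ^ 2 * n * fundUnit / 3 * h3
  rw [hY, hsu]
  calc s ^ 2 * fundUnit ≤ s ^ 2 * (|coordX (f - g)| * |coordY (f - g)|) := by gcongr
    _ = s * |coordX (f - g)| * (s * |coordY (f - g)|) := by ring
    _ ≤ 1 * (s * |coordY (f - g)|) := by gcongr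
    _ = s * |coordY (f - g)| := one_mul _

lemma exists_abs_sub_le_of_mem {n : ℕ} {D : Set (Fin 2 → ℝ)} (hn : 2 ≤ n)
    (hD : IsDesign n G₂ 1 D) {x : Fin 2 → ℝ} (hx : x ∈ D) (htop : ∃ y ∈ D, x 1 < y 1) :
    ∃ y ∈ D, x 1 < y 1 ∧ |y 1 - x 1| ≤ (2 * √3 / 3 + 1) / n := by
  obtain ⟨s, o, hs, hsn, -, hDeq⟩ := hD.exists_eq_image hn
  obtain ⟨z, hz, hxz⟩ := htop
  have hn0 : (0 : ℝ) < n := by positivity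
  have hs1 := le_one_of_sq_mul_eq_one hs hn hsn
  have hz1 : z 1 ≤ 1 := by
    rw [hDeq] at hz
    obtain ⟨g, hg, rfl⟩ := hz
    exact (hg 1).2
  have hx' := hx
  rw [hDeq] at hx'
  obtain ⟨f, hf, rfl⟩ := hx'
  have hf0 := hf 0
  have hf1 := hf 1
  obtain ⟨e, he1, he2, he3, he4⟩ := exists_gap (L := 1 / s) (t := designPoint s o f 0 / s)
    (by rw [le_div_iff₀ hs]; linarith) (div_nonneg hf0.1 hs.le) (by gcongr; exact hf0.2)
  have hX : designPoint s o (f + e) 0 = designPoint s o f 0 + s * coordX e := by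
    simp only [designPoint, Matrix.cons_val_zero, coordX_add]
    ring
  have hY : designPoint s o (f + e) 1 = designPoint s o f 1 + s * coordY e := by
    simp only [designPoint, Matrix.cons_val_zero, Matrix.cons_val_one, coordY_add]
    ring
  have hpos : 0 < s * coordY e := mul_pos hs he1
  have h3 : √3 * √3 = 3 := Real.mul_self_sqrt (by norm_num)
  have hsu : (2 * √3 / 3 + 1) / n = s ^ 2 * (2 * fundUnit ^ 2) := by
    rw [fundUnit_sq_sub_one] at hsn
    rw [div_eq_iff hn0.ne']
    have : (2 * √3 / 3 + 1) * √3 = fundUnit := by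
      rw [fundUnit]
      linear_combination 2 / 3 * h3
    linear_combination -(2 * √3 / 3 + 1) * hsn + 2 * s ^ 2 * n * fundUnit * this
  have hle : s * coordY e ≤ (2 * √3 / 3 + 1) / n := by
    rw [hsu]
    calc s * coordY e = s ^ 2 * (1 / s * coordY e) := by field_simp
      _ ≤ s ^ 2 * (2 * fundUnit ^ 2) := by gcongr
  rcases le_or_gt (designPoint s o (f + e) 1) 1 with h | h
  · refine ⟨designPoint s o (f + e), ?_, by linarith, ?_⟩
    · rw [hDeq]
      refine ⟨_, ?_, rfl⟩
      rw [Set.mem_ofPred_eq, Fin.forall_fin_two]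
      have e1 : designPoint s o f 0 / s * s = designPoint s o f 0 := div_mul_cancel₀ _ hs.ne'
      have e2 : 1 / s * s = 1 := div_mul_cancel₀ _ hs.ne'
      refine ⟨⟨?_, ?_⟩, by linarith [hf1.1], h⟩
      · rw [hX]
        nlinarith
      · rw [hX]
        nlinarith
    · rwa [hY, add_sub_cancel_left, abs_of_pos hpos]
  -- If the translated point leaves the square at the top, any higher design point z lies below it
  -- and inherits the bound.
  · refine ⟨z, hz, hxz, ?_⟩
    rw [abs_of_pos (by linarith)]
    linarith

end RSPD

theorem theorem4 :
    (∃ C : ℝ, ∀ (n : ℕ) (D : Set (Fin 2 → ℝ)), 2 ≤ n → RSPD.IsDesign n RSPD.G₂ 1 D →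
      RSPD.extremeDiscrepancy D ≤ C * (Real.log n / n)) ∧
    (∀ (n : ℕ) (D : Set (Fin 2 → ℝ)), 2 ≤ n → RSPD.IsDesign n RSPD.G₂ 1 D →
      (∀ x ∈ D, ∀ y ∈ D, x ≠ y → √3 / 6 / n ≤ |x 1 - y 1|) ∧
      (∀ x ∈ D, (∃ y ∈ D, x 1 < y 1) →
        ∃ y ∈ D, x 1 < y 1 ∧ |y 1 - x 1| ≤ (2 * √3 / 3 + 1) / n)) := by
  refine ⟨⟨60, fun n D hn hD => RSPD.extremeDiscrepancy_le hn hD⟩, fun n D hn hD => ⟨?_, ?_⟩⟩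
  · exact fun x hx y hy hxy => RSPD.le_abs_sub_of_mem hn hD hx hy hxy
  · exact fun x hx htop => RSPD.exists_abs_sub_le_of_mem hn hD hx htop
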